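/- All Hilbert spaces are finite-dimensional complex spaces and logarithms are to base $2$. For states (density matrices) $\rho,\sigma$ let $D_{\max}(\rho\|\sigma):=\log\min\{\lambda\in\mathbb{R}:\rho\le\lambda\sigma\}$, and $D_{\max}(\rho\|\sigma):=+\infty$ if no such $\lambda$ exists. For a state $\rho$ on a bipartite space $\mathcal{H}_A\otimes\mathcal{H}_B$ let $$E_{\max}(\rho):=\min_{\sigma\in\mathcal{D}}D_{\max}(\rho\|\sigma),$$ where $\mathcal{D}$ is the set of separable states, i.e. of convex combinations of product states $\alpha\otimes\beta$ on $\mathcal{H}_A\otimes\mathcal{H}_B$. Theorem. The minimum is attained and finite, and $E_{\max}$ is an entanglement monotone. That is, for every bipartite state $\rho$: (0) $E_{\max}(\rho)\ge 0$; (i) $E_{\max}(\rho)=0$ if and only if $\rho$ is separable; (ii) $E_{\max}\bigl((U\otimes V)\rho(U\otimes V)^\dagger\bigr)=E_{\max}(\rho)$ for all unitaries $U$ on $\mathcal{H}_A$ and $V$ on $\mathcal{H}_B$; (iii) $E_{\max}$ does not increase on average under local operations and classical communication (LOCC): if a protocol with finitely many rounds, in each of which one party applies to its own system a quantum instrument with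 finitely many outcomes (a finite family of completely positive maps whose sum is trace preserving; the dimension of the output may depend on the outcome) chosen depending on the earlier outcomes, and announces the outcome, ends with the classical record $k\in\{1,\dots,m\}$ (a function of the outcomes) with probability $p_k$ and then leaves the state $\rho_k$, then $$\sum_{k:\,p_k>0}p_k\,E_{\max}(\rho_k)\le E_{\max}(\rho).$$ -/

import Mathlib

open scoped Kronecker ComplexOrder

noncomputable section

namespace MaxRelEnt

/-- A state (density matrix): a positive semidefinite matrix of unit trace. -/
def IsState {n : Type*} [Fintype n] (ρ : Matrix n n ℂ) : Prop :=
  ρ.PosSemidef ∧ ρ.trace = 1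

/-- The max-relative entropy (base `2`) of `ρ` with respect to `σ`, i.e. the logarithm of the
least `l` with `ρ ≤ l σ`, as an extended real number. It is `⊤` if there is no such `l`.
Since the logarithm is increasing, the logarithm of the least `l` is the infimum of the
logarithms (see `dmax_eq_logb_of_isLeast`). -/
def dmax {n : Type*} [Fintype n] (ρ σ : Matrix n n ℂ) : EReal :=
  ⨅ l ∈ {l : ℝ | 0 < l ∧ (l • σ - ρ).PosSemidef}, ((Real.logb 2 l : ℝ) : EReal)

/-- For states, `dmax ρ σ` is the logarithm of the minimum of `{l | ρ ≤ l σ}`. -/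
theorem dmax_eq_logb_of_isLeast {n : Type*} [Fintype n] {ρ σ : Matrix n n ℂ}
    (hρ : IsState ρ) (hσ : IsState σ) {l : ℝ}
    (hl : IsLeast {l : ℝ | (l • σ - ρ).PosSemidef} l) :
    dmax ρ σ = ((Real.logb 2 l : ℝ) : EReal) := by
  have hpos : 0 < l := by
    have h : (0 : ℂ) ≤ (l • σ - ρ).trace := Matrix.PosSemidef.trace_nonneg hl.1
    rw [Matrix.trace_sub, Matrix.trace_smul, hρ.2, hσ.2] at h
    have h2 := (Complex.le_def.1 h).1
    simp at h2
    linarith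
  refine le_antisymm (iInf₂_le l ⟨hpos, hl.1⟩) (le_iInf₂ fun m hm => ?_)
  exact EReal.coe_le_coe_iff.2
    (Real.logb_le_logb_of_le (by norm_num) hpos (hl.2 hm.2))

/-- Operators on the bipartite system with local Hilbert spaces `ℂ^a` (Alice) and `ℂ^b` (Bob). -/
abbrev Op (a b : ℕ) : Type := Matrix (Fin a × Fin b) (Fin a × Fin b) ℂ

/-- The set of separable states: the convex combinations of product states. -/
def separableStates (a b : ℕ) : Set (Op a b) :=
  convexHull ℝ {σ | ∃ (α : Matrix (Fin a) (Fin a) ℂ) (β : Matrix (Fin b) (Fin b) ℂ),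
    IsState α ∧ IsState β ∧ σ = α ⊗ₖ β}

/-- The max-relative entropy of entanglement. -/
def emax (a b : ℕ) (ρ : Op a b) : EReal :=
  ⨅ σ ∈ separableStates a b, dmax ρ σ

/-- A quantum instrument on a local system `ℂ^d` with finitely many classical outcomes `i`,
in Kraus form: outcome `i` leaves the system in `ℂ^(dim i)` and corresponds to the completely
positive map with Kraus operators `K i j`; the sum of all these maps is trace preserving. -/
structure LocalInstrument (d : ℕ) where
  outcomes : ℕ
  dim : Fin outcomes → ℕ
  rank : Fin outcomes → ℕ
  K : (i : Fin outcomes) → Fin (rank i) → Matrix (Fin (dim i)) (Fin d) ℂ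
  complete : ∑ i, ∑ j, (K i j).conjTranspose * K i j = 1

/-- The unnormalised effect of outcome `i` when Alice applies the instrument to her part. -/
def LocalInstrument.onAlice {a : ℕ} (L : LocalInstrument a) (b : ℕ) (i : Fin L.outcomes)
    (X : Op a b) : Op (L.dim i) b :=
  ∑ j, (L.K i j ⊗ₖ (1 : Matrix (Fin b) (Fin b) ℂ)) * X *
    (L.K i j ⊗ₖ (1 : Matrix (Fin b) (Fin b) ℂ)).conjTranspose

/-- The unnormalised effect of outcome `i` when Bob applies the instrument to his part. -/
def LocalInstrument.onBob {b : ℕ} (L : LocalInstrument b) (a : ℕ) (i : Fin L.outcomes)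
    (X : Op a b) : Op a (L.dim i) :=
  ∑ j, ((1 : Matrix (Fin a) (Fin a) ℂ) ⊗ₖ L.K i j) * X *
    ((1 : Matrix (Fin a) (Fin a) ℂ) ⊗ₖ L.K i j).conjTranspose

/-- `IsLOCC a' b' a b Φ` says that the family of maps `Φ k`, from operators on `ℂ^a ⊗ ℂ^b` to
operators on `ℂ^(a' k) ⊗ ℂ^(b' k)`, is realised by a protocol of local operations and classical
communication with any finite number of rounds. Here `k` is the final classical record, and
`Φ k X` is the unnormalised output for the record `k`. A protocol either stops and declares a
record `k`, or one of the parties applies a local instrument, announces the outcome `i`, and the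
protocol continues in a way that may depend on `i`. As different branches may declare the same
record, the parties may forget classical information. -/
inductive IsLOCC {m : ℕ} (a' b' : Fin m → ℕ) :
    (a b : ℕ) → ((k : Fin m) → Op a b → Op (a' k) (b' k)) → Prop
  | halt (k : Fin m) (Φ : (l : Fin m) → Op (a' k) (b' k) → Op (a' l) (b' l))
      (same : ∀ X, Φ k X = X) (other : ∀ l, l ≠ k → ∀ X, Φ l X = 0) :
      IsLOCC a' b' (a' k) (b' k) Φ
  | alice (a b : ℕ) (L : LocalInstrument a)
      (Φ : (i : Fin L.outcomes) → (k : Fin m) → Op (L.dim i) b → Op (a' k) (b' k))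
      (next : ∀ i, IsLOCC a' b' (L.dim i) b (Φ i)) :
      IsLOCC a' b' a b (fun k X => ∑ i, Φ i k (L.onAlice b i X))
  | bob (a b : ℕ) (L : LocalInstrument b)
      (Φ : (i : Fin L.outcomes) → (k : Fin m) → Op a (L.dim i) → Op (a' k) (b' k))
      (next : ∀ i, IsLOCC a' b' a (L.dim i) (Φ i)) :
      IsLOCC a' b' a b (fun k X => ∑ i, Φ i k (L.onBob a i X))

/-- The probability of an outcome with unnormalised output `Y`. -/
def prob {a b : ℕ} (Y : Op a b) : ℝ := Y.trace.re

/-- The normalised state of an outcome with unnormalised output `Y` (of positive probability). -/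
def normalize {a b : ℕ} (Y : Op a b) : Op a b := (prob Y)⁻¹ • Y

/-- A quantity `E`, defined for the bipartite states of all finite dimensions, is an entanglement
monotone. In the last clause an outcome of probability zero contributes `0`
(`0 * x = 0` for every extended real `x`). -/
structure IsEntanglementMonotone (E : (a b : ℕ) → Op a b → EReal) : Prop where
  nonneg : ∀ (a b : ℕ) (ρ : Op a b), IsState ρ → 0 ≤ E a b ρ
  eq_zero_iff : ∀ (a b : ℕ) (ρ : Op a b), IsState ρ →
    (E a b ρ = 0 ↔ ρ ∈ separableStates a b)
  local_unitary : ∀ (a b : ℕ) (ρ : Op a b), IsState ρ →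
    ∀ U ∈ Matrix.unitaryGroup (Fin a) ℂ, ∀ V ∈ Matrix.unitaryGroup (Fin b) ℂ,
      E a b ((U ⊗ₖ V) * ρ * (U ⊗ₖ V).conjTranspose) = E a b ρ
  locc_average : ∀ (a b : ℕ) (ρ : Op a b), IsState ρ →
    ∀ (m : ℕ) (a' b' : Fin m → ℕ) (Φ : (k : Fin m) → Op a b → Op (a' k) (b' k)),
      IsLOCC a' b' a b Φ →
        ∑ k, ((prob (Φ k ρ) : ℝ) : EReal) * E (a' k) (b' k) (normalize (Φ k ρ)) ≤ E a b ρ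

end MaxRelEnt

end

/-!
The minimum defining `emax` is attained because the separable states form a compact set and the
positive semidefinite matrices a closed one; it is finite because every state is dominated by a
multiple of the separable, maximally mixed state (`exists_emax_eq_logb`). Comparing traces in
`ρ ≤ l σ` gives `1 ≤ l`, and in case of equality `σ - ρ` is positive of trace zero, so `ρ = σ`: this
is nonnegativity and faithfulness. Conjugation by a product operator `M ⊗ N` maps products to
products, hence preserves separability, which gives the invariance under local unitaries.

For LOCC, the maps `Φ k` of a protocol are positive and linear, preserve the cone of unnormalised
separable states, and preserve the trace when summed over `k`
(`IsSeparabilityPreserving.of_isLOCC`, by induction on the protocol). If `ρ ≤ l σ` with `σ`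
separable, then `Φ k ρ ≤ l Φ k σ`. With `p k` and `q k` the traces of `Φ k ρ` and `Φ k σ`, the
normalised outputs satisfy `ρ k ≤ (l q k / p k) σ k` with `σ k` separable, so that
`∑ p k * emax (ρ k) ≤ log l + ∑ p k * log (q k / p k)`. The last sum is minus the relative entropy
of two probability distributions, so it is at most `0`; this follows from `log x ≤ x - 1`. The
infimum over `l` and `σ` gives the claim.
-/

namespace MaxRelEnt

/-! ### Compactness of convex hulls -/

/-- In finite dimension the convex hull of a compact set is compact: by Carathéodory's theorem it
is a finite union, over `n ≤ dim E + 1`, of continuous images of `Δ × s ^ n`, with `Δ` the standard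
simplex on `n` vertices. -/
theorem isCompact_convexHull {E : Type*} [AddCommGroup E] [Module ℝ E] [TopologicalSpace E]
    [ContinuousAdd E] [ContinuousSMul ℝ E] [FiniteDimensional ℝ E] {s : Set E}
    (hs : IsCompact s) : IsCompact (convexHull ℝ s) := by
  have key : convexHull ℝ s = ⋃ n ∈ Finset.range (Module.finrank ℝ E + 2),
      (fun p : (Fin n → ℝ) × (Fin n → E) => ∑ i, p.1 i • p.2 i) ''
        (stdSimplex ℝ (Fin n) ×ˢ Set.univ.pi fun _ => s) := by
    apply Set.Subset.antisymm
    · intro x hx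
      obtain ⟨ι, _, z, w, hz, hind, hw, hw1, hx⟩ := eq_pos_convex_span_of_mem_convexHull hx
      have hcard : Fintype.card ι ≤ Module.finrank ℝ E + 1 :=
        hind.card_le_finrank_succ.trans (Nat.succ_le_succ (Submodule.finrank_le _))
      let e := Fintype.equivFin ι
      refine Set.mem_biUnion (x := Fintype.card ι) (by simp; omega)
        ⟨(w ∘ e.symm, z ∘ e.symm), ⟨⟨fun i => (hw _).le, ?_⟩, fun i _ => hz ⟨_, rfl⟩⟩, ?_⟩
      · exact (Equiv.sum_comp e.symm w).trans hw1
      · exact (Equiv.sum_comp e.symm fun i => w i • z i).trans hx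
    · refine Set.iUnion₂_subset fun n _ => ?_
      rintro _ ⟨p, ⟨hp, hps⟩, rfl⟩
      exact (convex_convexHull ℝ s).sum_mem (fun i _ => hp.1 i) hp.2
        fun i _ => subset_convexHull ℝ s (hps i trivial)
  rw [key]
  refine Finset.isCompact_biUnion _ fun n _ => IsCompact.image ?_ (by fun_prop)
  exact (isCompact_stdSimplex ℝ (Fin n)).prod (isCompact_univ_pi fun _ => hs)

/-! ### States and positive semidefinite matrices -/

section Matrices

variable {n m : Type*} [Fintype n] [Fintype m]

theorem isClosed_posSemidef : IsClosed {A : Matrix n n ℂ | A.PosSemidef} := by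
  simp only [Matrix.posSemidef_iff_dotProduct_mulVec, Set.ofPred_and, Set.ofPred_forall]
  refine IsClosed.inter (isClosed_eq (by fun_prop) continuous_id) (isClosed_iInter fun x => ?_)
  exact isClosed_le continuous_const (by fun_prop)

open scoped MatrixOrder in
theorem exists_eq_conjTranspose_mul_self {A : Matrix n n ℂ} (hA : A.PosSemidef) :
    ∃ B : Matrix n n ℂ, A = B.conjTranspose * B := by
  classical
  exact CStarAlgebra.nonneg_iff_eq_star_mul_self.mp hA.nonneg

/-- The states are the matrices `Bᴴ * B` with `B` on the Frobenius unit sphere. -/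
theorem isCompact_isState : IsCompact {ρ : Matrix n n ℂ | IsState ρ} := by
  classical
  have himage : {ρ : Matrix n n ℂ | IsState ρ} = (fun B : Matrix n n ℂ => B.conjTranspose * B) ''
      {B | (B.conjTranspose * B).trace = 1} := by
    ext ρ
    constructor
    · rintro ⟨h, h1⟩
      obtain ⟨B, rfl⟩ := exists_eq_conjTranspose_mul_self h
      exact ⟨B, h1, rfl⟩
    · rintro ⟨B, hB, rfl⟩
      exact ⟨Matrix.posSemidef_conjTranspose_mul_self B, hB⟩
  rw [himage]
  refine IsCompact.image ?_ (by fun_prop)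
  have hball : IsCompact (Set.univ.pi fun _ : n => Set.univ.pi fun _ : n =>
      Metric.closedBall (0 : ℂ) 1) :=
    isCompact_univ_pi fun _ => isCompact_univ_pi fun _ => isCompact_closedBall _ _
  refine hball.of_isClosed_subset (isClosed_eq (by fun_prop) continuous_const) ?_
  intro (B : Matrix n n ℂ) hB i _ j _
  have h : ∑ j, ∑ i, ‖B i j‖ ^ 2 = (1 : ℝ) := by
    have := congrArg Complex.re (show (B.conjTranspose * B).trace = 1 from hB)
    simpa [Matrix.trace, Matrix.mul_apply, Complex.conj_mul', ← Complex.ofReal_pow] using this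
  have h2 : ‖B i j‖ ^ 2 ≤ 1 := by
    rw [← h]
    exact (Finset.single_le_sum (f := fun i => ‖B i j‖ ^ 2) (fun _ _ => by positivity)
      (Finset.mem_univ i)).trans (Finset.single_le_sum (f := fun j => ∑ i, ‖B i j‖ ^ 2)
        (fun _ _ => by positivity) (Finset.mem_univ j))
  rw [mem_closedBall_zero_iff]
  exact (sq_le_one_iff₀ (norm_nonneg _)).1 h2

theorem IsState.posSemidef_one_sub [DecidableEq n] {ρ : Matrix n n ℂ} (hρ : IsState ρ) :
    (1 - ρ).PosSemidef := by
  have hH := hρ.1.isHermitian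
  have hsum : ∑ i, hH.eigenvalues i = 1 := by
    have := hH.trace_eq_sum_eigenvalues
    rw [hρ.2] at this
    simpa using (congrArg Complex.re this).symm
  have hle : ∀ i, hH.eigenvalues i ≤ 1 := fun i => by
    rw [← hsum]
    exact Finset.single_le_sum (fun j _ => hρ.1.eigenvalues_nonneg j) (Finset.mem_univ i)
  have hD : (1 - Matrix.diagonal (fun i => (hH.eigenvalues i : ℂ))).PosSemidef := by
    rw [← Matrix.diagonal_one, Matrix.diagonal_sub]
    refine Matrix.PosSemidef.diagonal fun i => ?_
    have : (0 : ℂ) ≤ ((1 - hH.eigenvalues i : ℝ) : ℂ) :=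
      Complex.zero_le_real.2 (sub_nonneg.2 (hle i))
    simpa using this
  have hU := hD.mul_mul_conjTranspose_same (hH.eigenvectorUnitary : Matrix n n ℂ)
  convert hU using 1
  have hs := hH.spectral_theorem
  rw [Unitary.conjStarAlgAut_apply] at hs
  rw [mul_sub, sub_mul, mul_one]
  congr 1
  exact (Unitary.mul_star_self_of_mem hH.eigenvectorUnitary.2).symm

theorem IsState.kronecker {α : Matrix n n ℂ} {β : Matrix m m ℂ} (hα : IsState α)
    (hβ : IsState β) : IsState (α ⊗ₖ β) :=
  ⟨hα.1.kronecker hβ.1, by rw [Matrix.trace_kronecker, hα.2, hβ.2, one_mul]⟩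

theorem convex_isState : Convex ℝ {ρ : Matrix n n ℂ | IsState ρ} := by
  intro x hx y hy s t hs ht hst
  refine ⟨(hx.1.smul hs).add (hy.1.smul ht), ?_⟩
  rw [Matrix.trace_add, Matrix.trace_smul, Matrix.trace_smul, hx.2, hy.2, ← add_smul, hst,
    one_smul]

theorem ofReal_trace_re {A : Matrix n n ℂ} (hA : A.PosSemidef) :
    ((A.trace.re : ℝ) : ℂ) = A.trace :=
  (Complex.eq_re_of_ofReal_le (r := 0) (by simpa using hA.trace_nonneg)).symm

theorem trace_re_nonneg {A : Matrix n n ℂ} (hA : A.PosSemidef) : 0 ≤ A.trace.re :=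
  (Complex.le_def.1 hA.trace_nonneg).1

theorem isState_normalized {A : Matrix n n ℂ} (hA : A.PosSemidef) (h : 0 < A.trace.re) :
    IsState ((A.trace.re)⁻¹ • A) := by
  refine ⟨hA.smul (inv_nonneg.2 h.le), ?_⟩
  rw [Matrix.trace_smul, ← ofReal_trace_re hA, Complex.real_smul, ← Complex.ofReal_mul,
    Complex.ofReal_re, inv_mul_cancel₀ h.ne', Complex.ofReal_one]

theorem eq_zero_or_trace_re_pos {A : Matrix n n ℂ} (hA : A.PosSemidef) :
    A = 0 ∨ 0 < A.trace.re := by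
  rcases (trace_re_nonneg hA).eq_or_lt with h | h
  · exact Or.inl (hA.trace_eq_zero_iff.1 (by rw [← ofReal_trace_re hA, ← h, Complex.ofReal_zero]))
  · exact Or.inr h

theorem one_le_of_posSemidef_smul_sub {ρ σ : Matrix n n ℂ} (hρ : IsState ρ) (hσ : IsState σ)
    {l : ℝ} (h : (l • σ - ρ).PosSemidef) : 1 ≤ l := by
  have h := trace_re_nonneg h
  rw [Matrix.trace_sub, Matrix.trace_smul, hρ.2, hσ.2] at h
  simpa using h

end Matrices

/-! ### The cone of unnormalised separable states -/

/-- The convex cone spanned by the products of positive semidefinite matrices: the unnormalised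
separable states. Sums suffice in the definition, as the generators are closed under nonnegative
multiples. -/
def separableCone (a b : ℕ) : AddSubmonoid (Op a b) :=
  AddSubmonoid.closure {X | ∃ (A : Matrix (Fin a) (Fin a) ℂ) (B : Matrix (Fin b) (Fin b) ℂ),
    A.PosSemidef ∧ B.PosSemidef ∧ X = A ⊗ₖ B}

theorem kronecker_mem_separableCone {a b : ℕ} {A : Matrix (Fin a) (Fin a) ℂ}
    {B : Matrix (Fin b) (Fin b) ℂ} (hA : A.PosSemidef) (hB : B.PosSemidef) :
    A ⊗ₖ B ∈ separableCone a b :=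
  AddSubmonoid.subset_closure ⟨A, B, hA, hB, rfl⟩

theorem smul_mem_separableCone {a b : ℕ} {X : Op a b} (hX : X ∈ separableCone a b) {t : ℝ}
    (ht : 0 ≤ t) : t • X ∈ separableCone a b := by
  induction hX using AddSubmonoid.closure_induction with
  | mem X h =>
    obtain ⟨A, B, hA, hB, rfl⟩ := h
    rw [← Matrix.smul_kronecker]
    exact kronecker_mem_separableCone (hA.smul ht) hB
  | zero => rw [smul_zero]; exact zero_mem _
  | add X Y _ _ hX hY => rw [smul_add]; exact add_mem hX hY

theorem posSemidef_of_mem_separableCone {a b : ℕ} {X : Op a b} (hX : X ∈ separableCone a b) :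
    X.PosSemidef := by
  induction hX using AddSubmonoid.closure_induction with
  | mem X h => obtain ⟨A, B, hA, hB, rfl⟩ := h; exact hA.kronecker hB
  | zero => exact Matrix.PosSemidef.zero
  | add X Y _ _ hX hY => exact hX.add hY

theorem isState_of_mem_separableStates {a b : ℕ} {σ : Op a b} (h : σ ∈ separableStates a b) :
    IsState σ := by
  refine convexHull_min ?_ convex_isState h
  rintro _ ⟨α, β, hα, hβ, rfl⟩
  exact hα.kronecker hβ

theorem mem_separableCone_of_mem_separableStates {a b : ℕ} {σ : Op a b}
    (h : σ ∈ separableStates a b) : σ ∈ separableCone a b := by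
  refine convexHull_min (t := (separableCone a b : Set (Op a b))) ?_ ?_ h
  · rintro _ ⟨α, β, hα, hβ, rfl⟩
    exact kronecker_mem_separableCone hα.1 hβ.1
  · intro x hx y hy s t hs ht _
    exact add_mem (smul_mem_separableCone hx hs) (smul_mem_separableCone hy ht)

theorem eq_zero_or_eq_smul_of_mem_separableCone {a b : ℕ} {X : Op a b}
    (hX : X ∈ separableCone a b) :
    X = 0 ∨ ∃ t : ℝ, 0 < t ∧ ∃ σ ∈ separableStates a b, X = t • σ := by
  induction hX using AddSubmonoid.closure_induction with
  | mem X h =>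
    obtain ⟨A, B, hA, hB, rfl⟩ := h
    rcases eq_zero_or_trace_re_pos hA with rfl | hA0
    · exact Or.inl (Matrix.zero_kronecker _)
    rcases eq_zero_or_trace_re_pos hB with rfl | hB0
    · exact Or.inl (Matrix.kronecker_zero _)
    refine Or.inr ⟨A.trace.re * B.trace.re, mul_pos hA0 hB0, _, subset_convexHull ℝ _
      ⟨_, _, isState_normalized hA hA0, isState_normalized hB hB0, rfl⟩, ?_⟩
    rw [Matrix.smul_kronecker, Matrix.kronecker_smul, smul_smul, smul_smul,
      show A.trace.re * B.trace.re * (A.trace.re)⁻¹ * (B.trace.re)⁻¹ = 1 by field_simp, one_smul]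
  | zero => exact Or.inl rfl
  | add X Y _ _ hX hY =>
    rcases hX with rfl | ⟨s, hs, σ, hσ, rfl⟩
    · rwa [zero_add]
    rcases hY with rfl | ⟨t, ht, τ, hτ, rfl⟩
    · rw [add_zero]; exact Or.inr ⟨s, hs, σ, hσ, rfl⟩
    have hst : s + t ≠ 0 := (add_pos hs ht).ne'
    refine Or.inr ⟨s + t, add_pos hs ht, (s / (s + t)) • σ + (t / (s + t)) • τ,
      convex_convexHull ℝ _ hσ hτ (by positivity) (by positivity) (by field_simp), ?_⟩
    rw [smul_add, smul_smul, smul_smul, mul_div_cancel₀ _ hst, mul_div_cancel₀ _ hst]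

theorem mem_separableStates_of_mem_separableCone {a b : ℕ} {X : Op a b}
    (hX : X ∈ separableCone a b) (h1 : X.trace = 1) : X ∈ separableStates a b := by
  rcases eq_zero_or_eq_smul_of_mem_separableCone hX with rfl | ⟨t, ht, σ, hσ, rfl⟩
  · simp at h1
  · rw [Matrix.trace_smul, (isState_of_mem_separableStates hσ).2] at h1
    have : t = 1 := by simpa using congrArg Complex.re h1
    rwa [this, one_smul]

theorem conj_kronecker_mem_separableCone {a b c d : ℕ} (M : Matrix (Fin c) (Fin a) ℂ)
    (N : Matrix (Fin d) (Fin b) ℂ) {X : Op a b} (hX : X ∈ separableCone a b) :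
    (M ⊗ₖ N) * X * (M ⊗ₖ N).conjTranspose ∈ separableCone c d := by
  induction hX using AddSubmonoid.closure_induction with
  | mem X h =>
    obtain ⟨A, B, hA, hB, rfl⟩ := h
    rw [Matrix.conjTranspose_kronecker, ← Matrix.mul_kronecker_mul, ← Matrix.mul_kronecker_mul]
    exact kronecker_mem_separableCone (hA.mul_mul_conjTranspose_same M)
      (hB.mul_mul_conjTranspose_same N)
  | zero => rw [Matrix.mul_zero, Matrix.zero_mul]; exact zero_mem _
  | add X Y _ _ hX hY => rw [Matrix.mul_add, Matrix.add_mul]; exact add_mem hX hY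

theorem isCompact_separableStates (a b : ℕ) : IsCompact (separableStates a b) := by
  refine isCompact_convexHull ?_
  have himage : {σ : Op a b | ∃ (α : Matrix (Fin a) (Fin a) ℂ) (β : Matrix (Fin b) (Fin b) ℂ),
      IsState α ∧ IsState β ∧ σ = α ⊗ₖ β} =
      (fun p : Matrix (Fin a) (Fin a) ℂ × Matrix (Fin b) (Fin b) ℂ => p.1 ⊗ₖ p.2) ''
        ({α | IsState α} ×ˢ {β | IsState β}) := by
    ext σ
    constructor
    · rintro ⟨α, β, hα, hβ, rfl⟩
      exact ⟨(α, β), ⟨hα, hβ⟩, rfl⟩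
    · rintro ⟨⟨α, β⟩, ⟨hα, hβ⟩, rfl⟩
      exact ⟨α, β, hα, hβ, rfl⟩
  rw [himage]
  refine (isCompact_isState.prod isCompact_isState).image ?_
  refine continuous_matrix fun i j => ?_
  simp only [Matrix.kroneckerMap_apply]
  fun_prop

/-! ### Attainment of the minimum, and faithfulness -/

theorem emax_le_of_posSemidef {a b : ℕ} {ρ σ : Op a b} (hσ : σ ∈ separableStates a b) {l : ℝ}
    (hl : 0 < l) (h : (l • σ - ρ).PosSemidef) : emax a b ρ ≤ ((Real.logb 2 l : ℝ) : EReal) :=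
  (iInf₂_le σ hσ).trans (iInf₂_le l ⟨hl, h⟩)

theorem le_emax {a b : ℕ} {ρ : Op a b} {x : EReal}
    (h : ∀ σ ∈ separableStates a b, ∀ l : ℝ, 0 < l → (l • σ - ρ).PosSemidef →
      x ≤ ((Real.logb 2 l : ℝ) : EReal)) : x ≤ emax a b ρ :=
  le_iInf₂ fun σ hσ => le_iInf₂ fun l hl => h σ hσ l hl.1 hl.2

/-- The maximally mixed state is separable, and every state is dominated by a multiple of it. -/
theorem exists_separable_dominating {a b : ℕ} {ρ : Op a b} (hρ : IsState ρ) :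
    ∃ σ ∈ separableStates a b, ∃ l : ℝ, (l • σ - ρ).PosSemidef := by
  have hone : (1 : Op a b) ∈ separableCone a b := by
    rw [← Matrix.one_kronecker_one]
    exact kronecker_mem_separableCone Matrix.PosSemidef.one Matrix.PosSemidef.one
  have hle := hρ.posSemidef_one_sub
  rcases eq_zero_or_eq_smul_of_mem_separableCone hone with h0 | ⟨t, _, σ, hσ, h⟩
  · -- If the space is zero then `ρ` cannot have trace one.
    have := hρ.2
    rw [← Matrix.mul_one ρ, h0, Matrix.mul_zero, Matrix.trace_zero] at this
    exact absurd this zero_ne_one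
  · exact ⟨σ, hσ, t, h ▸ hle⟩

/-- The least `l` with `ρ ≤ l σ` for some separable `σ` exists, as the pairs `(l, σ)` with
`1 ≤ l ≤ L` form a compact set, and its logarithm is `emax a b ρ`. -/
theorem exists_emax_eq_logb {a b : ℕ} {ρ : Op a b} (hρ : IsState ρ) :
    ∃ σ ∈ separableStates a b, ∃ l : ℝ, 1 ≤ l ∧ (l • σ - ρ).PosSemidef ∧
      dmax ρ σ = emax a b ρ ∧ emax a b ρ = ((Real.logb 2 l : ℝ) : EReal) := by
  obtain ⟨σ₁, hσ₁, L, hL⟩ := exists_separable_dominating hρ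
  have hL1 := one_le_of_posSemidef_smul_sub hρ (isState_of_mem_separableStates hσ₁) hL
  let S : Set (ℝ × Op a b) := (Set.Icc 1 L ×ˢ separableStates a b) ∩
    {p | (p.1 • p.2 - ρ).PosSemidef}
  have hS : IsCompact S := (isCompact_Icc.prod (isCompact_separableStates a b)).inter_right
    (isClosed_posSemidef.preimage (by fun_prop))
  obtain ⟨⟨l, σ⟩, ⟨⟨hl, hσ⟩, hlσ⟩, hmin⟩ :=
    hS.exists_isMinOn ⟨(L, σ₁), ⟨⟨hL1, le_rfl⟩, hσ₁⟩, hL⟩ continuous_fst.continuousOn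
  have hl0 : 0 < l := one_pos.trans_le hl.1
  have hle : ((Real.logb 2 l : ℝ) : EReal) ≤ emax a b ρ := by
    refine le_emax fun τ hτ t ht h => EReal.coe_le_coe_iff.2
      (Real.logb_le_logb_of_le (by norm_num) hl0 ?_)
    have h1 := one_le_of_posSemidef_smul_sub hρ (isState_of_mem_separableStates hτ) h
    rcases le_total t L with htL | htL
    · exact isMinOn_iff.1 hmin (t, τ) ⟨⟨⟨h1, htL⟩, hτ⟩, h⟩
    · exact hl.2.trans htL
  have hd : dmax ρ σ ≤ ((Real.logb 2 l : ℝ) : EReal) := iInf₂_le l ⟨hl0, hlσ⟩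
  have he : emax a b ρ ≤ dmax ρ σ := iInf₂_le σ hσ
  exact ⟨σ, hσ, l, hl.1, hlσ, le_antisymm (hd.trans hle) he, le_antisymm (he.trans hd) hle⟩

theorem emax_nonneg {a b : ℕ} {ρ : Op a b} (hρ : IsState ρ) : 0 ≤ emax a b ρ := by
  obtain ⟨σ, _, l, hl, _, _, h⟩ := exists_emax_eq_logb hρ
  rw [h]
  exact_mod_cast Real.logb_nonneg (by norm_num) hl

theorem emax_eq_zero_iff {a b : ℕ} {ρ : Op a b} (hρ : IsState ρ) :
    emax a b ρ = 0 ↔ ρ ∈ separableStates a b := by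
  constructor
  · intro h0
    obtain ⟨σ, hσ, l, hl, hlσ, _, h⟩ := exists_emax_eq_logb hρ
    have hlog : Real.logb 2 l = 0 := by exact_mod_cast h.symm.trans h0
    have hl1 : l = 1 := by
      rcases hl.eq_or_lt with h1 | h1
      · exact h1.symm
      · exact absurd hlog (Real.logb_pos (by norm_num) h1).ne'
    rw [hl1, one_smul] at hlσ
    -- `σ - ρ` is positive semidefinite of trace zero.
    have hz := hlσ.trace_eq_zero_iff.1
      (by rw [Matrix.trace_sub, (isState_of_mem_separableStates hσ).2, hρ.2, sub_self])
    rwa [← sub_eq_zero.1 hz]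
  · intro h
    refine le_antisymm ?_ (emax_nonneg hρ)
    have := emax_le_of_posSemidef (ρ := ρ) h one_pos
      (by rw [one_smul, sub_self]; exact Matrix.PosSemidef.zero)
    simpa using this

/-! ### Local unitaries -/

theorem conjTranspose_kronecker_mul_self_of_mem_unitaryGroup {a b : ℕ} {U : Matrix (Fin a) (Fin a) ℂ}
    {V : Matrix (Fin b) (Fin b) ℂ} (hU : U ∈ Matrix.unitaryGroup (Fin a) ℂ)
    (hV : V ∈ Matrix.unitaryGroup (Fin b) ℂ) :
    (U ⊗ₖ V).conjTranspose * (U ⊗ₖ V) = 1 := by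
  have hU' : U.conjTranspose * U = 1 := Matrix.mem_unitaryGroup_iff'.1 hU
  have hV' : V.conjTranspose * V = 1 := Matrix.mem_unitaryGroup_iff'.1 hV
  rw [Matrix.conjTranspose_kronecker, ← Matrix.mul_kronecker_mul, hU', hV',
    Matrix.one_kronecker_one]

theorem emax_conj_le {a b : ℕ} (ρ : Op a b) {U : Matrix (Fin a) (Fin a) ℂ}
    {V : Matrix (Fin b) (Fin b) ℂ} (hU : U ∈ Matrix.unitaryGroup (Fin a) ℂ)
    (hV : V ∈ Matrix.unitaryGroup (Fin b) ℂ) :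
    emax a b ((U ⊗ₖ V) * ρ * (U ⊗ₖ V).conjTranspose) ≤ emax a b ρ := by
  refine le_emax fun σ hσ l hl h => emax_le_of_posSemidef
    (σ := (U ⊗ₖ V) * σ * (U ⊗ₖ V).conjTranspose) ?_ hl ?_
  · refine mem_separableStates_of_mem_separableCone (conj_kronecker_mem_separableCone U V
      (mem_separableCone_of_mem_separableStates hσ)) ?_
    rw [Matrix.trace_mul_cycle, conjTranspose_kronecker_mul_self_of_mem_unitaryGroup hU hV,
      Matrix.one_mul, (isState_of_mem_separableStates hσ).2]
  · simpa [Matrix.mul_sub, Matrix.sub_mul] using h.mul_mul_conjTranspose_same (U ⊗ₖ V)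

theorem emax_conj {a b : ℕ} (ρ : Op a b) {U : Matrix (Fin a) (Fin a) ℂ}
    {V : Matrix (Fin b) (Fin b) ℂ} (hU : U ∈ Matrix.unitaryGroup (Fin a) ℂ)
    (hV : V ∈ Matrix.unitaryGroup (Fin b) ℂ) :
    emax a b ((U ⊗ₖ V) * ρ * (U ⊗ₖ V).conjTranspose) = emax a b ρ := by
  refine le_antisymm (emax_conj_le ρ hU hV) ?_
  have h := emax_conj_le ((U ⊗ₖ V) * ρ * (U ⊗ₖ V).conjTranspose)
    (Unitary.star_mem hU) (Unitary.star_mem hV)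
  have hW := conjTranspose_kronecker_mul_self_of_mem_unitaryGroup hU hV
  rw [Matrix.star_eq_conjTranspose, Matrix.star_eq_conjTranspose, ← Matrix.conjTranspose_kronecker,
    Matrix.conjTranspose_conjTranspose] at h
  rwa [show (U ⊗ₖ V).conjTranspose * ((U ⊗ₖ V) * ρ * (U ⊗ₖ V).conjTranspose) * (U ⊗ₖ V) =
    ((U ⊗ₖ V).conjTranspose * (U ⊗ₖ V)) * ρ * ((U ⊗ₖ V).conjTranspose * (U ⊗ₖ V)) by
      simp only [Matrix.mul_assoc], hW, Matrix.one_mul, Matrix.mul_one] at h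

/-! ### LOCC protocols preserve the separable cone -/

/-- The properties of an LOCC protocol that bound `emax`: a family of positive real-linear maps
that together preserve the trace and each of which preserves the separable cone. -/
structure IsSeparabilityPreserving {m : ℕ} {a' b' : Fin m → ℕ} {a b : ℕ}
    (Φ : (k : Fin m) → Op a b → Op (a' k) (b' k)) : Prop where
  map_smul_sub : ∀ (k : Fin m) (l : ℝ) (X Y : Op a b), Φ k (l • X - Y) = l • Φ k X - Φ k Y
  posSemidef : ∀ (k : Fin m) (X : Op a b), X.PosSemidef → (Φ k X).PosSemidef
  mem_cone : ∀ (k : Fin m), ∀ X ∈ separableCone a b, Φ k X ∈ separableCone (a' k) (b' k)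
  sum_trace : ∀ X : Op a b, ∑ k, (Φ k X).trace = X.trace

namespace IsSeparabilityPreserving

theorem of_kraus {n : ℕ} {a' b' r : Fin n → ℕ} {a b : ℕ}
    (M : (i : Fin n) → Fin (r i) → Matrix (Fin (a' i)) (Fin a) ℂ)
    (N : (i : Fin n) → Fin (r i) → Matrix (Fin (b' i)) (Fin b) ℂ)
    (complete : ∑ i, ∑ j, (M i j ⊗ₖ N i j).conjTranspose * (M i j ⊗ₖ N i j) = 1) :
    IsSeparabilityPreserving fun i (X : Op a b) =>
      ∑ j, (M i j ⊗ₖ N i j) * X * (M i j ⊗ₖ N i j).conjTranspose where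
  map_smul_sub i l X Y := by
    simp [Matrix.mul_sub, Matrix.sub_mul, Finset.smul_sum]
  posSemidef i X hX := Matrix.posSemidef_sum _ fun j _ => hX.mul_mul_conjTranspose_same _
  mem_cone i X hX := sum_mem fun j _ => conj_kronecker_mem_separableCone _ _ hX
  sum_trace X := by
    simp_rw [Matrix.trace_sum, Matrix.trace_mul_cycle _ X, ← Matrix.trace_sum, ← Finset.sum_mul]
    rw [complete, Matrix.one_mul]

theorem onAlice {a : ℕ} (L : LocalInstrument a) (b : ℕ) :
    IsSeparabilityPreserving (L.onAlice b) := by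
  refine of_kraus L.K (fun _ _ => 1) ?_
  simp_rw [Matrix.conjTranspose_kronecker, ← Matrix.mul_kronecker_mul, Matrix.conjTranspose_one,
    Matrix.one_mul]
  let f : Matrix (Fin a) (Fin a) ℂ →+ Op a b :=
    AddMonoidHom.mk' (fun A => A ⊗ₖ 1) fun A B => Matrix.add_kronecker A B 1
  change ∑ i, ∑ j, f ((L.K i j).conjTranspose * L.K i j) = 1
  simp_rw [← map_sum, L.complete]
  exact Matrix.one_kronecker_one

theorem onBob {b : ℕ} (L : LocalInstrument b) (a : ℕ) :
    IsSeparabilityPreserving (L.onBob a) := by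
  refine of_kraus (fun _ _ => 1) L.K ?_
  simp_rw [Matrix.conjTranspose_kronecker, ← Matrix.mul_kronecker_mul, Matrix.conjTranspose_one,
    Matrix.one_mul]
  let f : Matrix (Fin b) (Fin b) ℂ →+ Op a b :=
    AddMonoidHom.mk' (fun B => 1 ⊗ₖ B) fun A B => Matrix.kronecker_add 1 A B
  change ∑ i, ∑ j, f ((L.K i j).conjTranspose * L.K i j) = 1
  simp_rw [← map_sum, L.complete]
  exact Matrix.one_kronecker_one

theorem comp {n m : ℕ} {a₁ b₁ : Fin n → ℕ} {a' b' : Fin m → ℕ} {a b : ℕ}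
    {Λ : (i : Fin n) → Op a b → Op (a₁ i) (b₁ i)} (hΛ : IsSeparabilityPreserving Λ)
    {Φ : (i : Fin n) → (k : Fin m) → Op (a₁ i) (b₁ i) → Op (a' k) (b' k)}
    (hΦ : ∀ i, IsSeparabilityPreserving (Φ i)) :
    IsSeparabilityPreserving fun k X => ∑ i, Φ i k (Λ i X) where
  map_smul_sub k l X Y := by
    simp_rw [hΛ.map_smul_sub, (hΦ _).map_smul_sub, Finset.smul_sum, Finset.sum_sub_distrib]
  posSemidef k X hX := Matrix.posSemidef_sum _ fun i _ =>
    (hΦ i).posSemidef k _ (hΛ.posSemidef i X hX)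
  mem_cone k X hX := sum_mem fun i _ => (hΦ i).mem_cone k _ (hΛ.mem_cone i X hX)
  sum_trace X := by
    simp_rw [Matrix.trace_sum]
    rw [Finset.sum_comm]
    simp_rw [(hΦ _).sum_trace, hΛ.sum_trace]

theorem of_isLOCC {m : ℕ} {a' b' : Fin m → ℕ} {a b : ℕ}
    {Φ : (k : Fin m) → Op a b → Op (a' k) (b' k)} (h : IsLOCC a' b' a b Φ) :
    IsSeparabilityPreserving Φ := by
  induction h with
  | halt k Φ same other =>
    refine ⟨fun l t X Y => ?_, fun l X hX => ?_, fun l X hX => ?_, fun X => ?_⟩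
    · by_cases hl : l = k
      · subst hl; simp_rw [same]
      · simp [other l hl]
    · by_cases hl : l = k
      · subst hl; rwa [same]
      · rw [other l hl]; exact Matrix.PosSemidef.zero
    · by_cases hl : l = k
      · subst hl; rwa [same]
      · rw [other l hl]; exact zero_mem _
    · rw [Finset.sum_eq_single k, same]
      · intro l _ hl
        rw [other l hl, Matrix.trace_zero]
      · simp
  | alice a b L Φ _ ih => exact (onAlice L b).comp ih
  | bob a b L Φ _ ih => exact (onBob L a).comp ih

end IsSeparabilityPreserving

/-! ### Monotonicity on average -/

/-- If the outcomes of `ρ` and of a separable `σ` with `ρ ≤ l σ` have the unnormalised outputs `P`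
and `Q`, of traces `p` and `q`, then `P / p ≤ (l q / p) (Q / q)`. With `log x ≤ x - 1` the
resulting bound on `p * emax (P / p)` becomes affine in `p` and `q`, so that it can be summed over
the outcomes. -/
theorem prob_mul_emax_normalize_le {a b : ℕ} {P Q : Op a b} (hP : P.PosSemidef)
    (hQ : Q ∈ separableCone a b) {l : ℝ} (hl : 0 < l) (h : (l • Q - P).PosSemidef) :
    ((prob P : ℝ) : EReal) * emax a b (normalize P) ≤
      ((prob P * Real.logb 2 l + (prob Q - prob P) / Real.log 2 : ℝ) : EReal) := by
  have hlog2 : 0 < Real.log 2 := Real.log_pos (by norm_num)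
  rcases (trace_re_nonneg hP).eq_or_lt with hp | hp
  · have hp' : prob P = 0 := hp.symm
    have hq : 0 ≤ prob Q := trace_re_nonneg (posSemidef_of_mem_separableCone hQ)
    rw [hp', EReal.coe_zero, zero_mul, zero_mul, zero_add, sub_zero]
    exact EReal.coe_nonneg.2 (by positivity)
  change 0 < prob P at hp
  have hle : prob P ≤ l * prob Q := by
    have := trace_re_nonneg h
    rw [Matrix.trace_sub, Matrix.trace_smul] at this
    simpa [prob] using this
  have hq : 0 < prob Q := pos_of_mul_pos_right (hp.trans_le hle) hl.le
  have hQ' := posSemidef_of_mem_separableCone hQ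
  have hE : emax a b (normalize P) ≤
      ((Real.logb 2 (l * prob Q / prob P) : ℝ) : EReal) := by
    refine emax_le_of_posSemidef (σ := normalize Q) ?_ (by positivity) ?_
    · exact mem_separableStates_of_mem_separableCone
        (smul_mem_separableCone hQ (inv_nonneg.2 hq.le)) (isState_normalized hQ' hq).2
    · have : (l * prob Q / prob P) • normalize Q - normalize P =
          (prob P)⁻¹ • (l • Q - P) := by
        rw [normalize, normalize, smul_sub, smul_smul, smul_smul]
        congr 2
        field_simp
      rw [this]
      exact h.smul (inv_nonneg.2 hp.le)
  refine (mul_le_mul_of_nonneg_left hE (EReal.coe_nonneg.2 hp.le)).trans ?_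
  rw [← EReal.coe_mul, EReal.coe_le_coe_iff]
  have hx : Real.log (prob Q / prob P) ≤ prob Q / prob P - 1 :=
    Real.log_le_sub_one_of_pos (by positivity)
  rw [mul_div_assoc, Real.logb_mul hl.ne' (by positivity), mul_add]
  refine add_le_add le_rfl ?_
  rw [Real.logb, ← mul_div_assoc, div_le_div_iff_of_pos_right hlog2]
  calc prob P * Real.log (prob Q / prob P) ≤ prob P * (prob Q / prob P - 1) :=
        mul_le_mul_of_nonneg_left hx hp.le
    _ = prob Q - prob P := by field_simp

theorem coe_sum_ereal {ι : Type*} (s : Finset ι) (f : ι → ℝ) :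
    ((∑ i ∈ s, f i : ℝ) : EReal) = ∑ i ∈ s, ((f i : ℝ) : EReal) := by
  let c : ℝ →+ EReal := ⟨⟨fun x => x, EReal.coe_zero⟩, EReal.coe_add⟩
  exact map_sum c f s

theorem sum_prob_mul_emax_le {m : ℕ} {a' b' : Fin m → ℕ} {a b : ℕ} {ρ : Op a b} (hρ : IsState ρ)
    {Φ : (k : Fin m) → Op a b → Op (a' k) (b' k)} (hΦ : IsSeparabilityPreserving Φ) :
    ∑ k, ((prob (Φ k ρ) : ℝ) : EReal) * emax (a' k) (b' k) (normalize (Φ k ρ)) ≤ emax a b ρ := by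
  refine le_emax fun σ hσ l hl h => ?_
  have hsum : ∀ X : Op a b, IsState X → ∑ k, prob (Φ k X) = 1 := fun X hX => by
    simp_rw [prob, ← Complex.re_sum, hΦ.sum_trace, hX.2, Complex.one_re]
  refine (Finset.sum_le_sum fun k _ => prob_mul_emax_normalize_le (hΦ.posSemidef k ρ hρ.1)
    (hΦ.mem_cone k σ (mem_separableCone_of_mem_separableStates hσ)) hl ?_).trans_eq ?_
  · rw [← hΦ.map_smul_sub]
    exact hΦ.posSemidef k _ h
  · rw [← coe_sum_ereal, Finset.sum_add_distrib, ← Finset.sum_mul, ← Finset.sum_div,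
      Finset.sum_sub_distrib, hsum ρ hρ, hsum σ (isState_of_mem_separableStates hσ)]
    simp

end MaxRelEnt

theorem theorem1 :
    (∀ (a b : ℕ) (ρ : MaxRelEnt.Op a b), MaxRelEnt.IsState ρ →
      MaxRelEnt.emax a b ρ ≠ ⊤ ∧
      ∃ σ ∈ MaxRelEnt.separableStates a b, MaxRelEnt.dmax ρ σ = MaxRelEnt.emax a b ρ) ∧
    MaxRelEnt.IsEntanglementMonotone MaxRelEnt.emax := by
  refine ⟨fun a b ρ hρ => ?_, fun a b ρ hρ => MaxRelEnt.emax_nonneg hρ,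
    fun a b ρ hρ => MaxRelEnt.emax_eq_zero_iff hρ,
    fun a b ρ _ U hU V hV => MaxRelEnt.emax_conj ρ hU hV,
    fun a b ρ hρ m a' b' Φ hΦ =>
      MaxRelEnt.sum_prob_mul_emax_le hρ (MaxRelEnt.IsSeparabilityPreserving.of_isLOCC hΦ)⟩
  obtain ⟨σ, hσ, l, _, _, hd, he⟩ := MaxRelEnt.exists_emax_eq_logb hρ
  exact ⟨he ▸ EReal.coe_ne_top _, σ, hσ, hd⟩
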